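/- Let $E$ be a complex Banach space, $E^*$ its (complex) dual, and $E_{\mathbb R}$ the space $E$ regarded as a real Banach space. For $z^*\in E^*$, let $\mathfrak{Re}\,z^*\in (E_{\mathbb R})^*$ be its real part, $z\mapsto \mathfrak{Re}\,(z^*(z))$. Let $\mathrm{FBL}[E_{\mathbb R}]$ be the free Banach lattice generated by $E_{\mathbb R}$: with $$\|f\|=\sup\Big\{\sum_{i=1}^n|f(x_i^*)| : n\in\mathbb N,\ x_1^*,\dots,x_n^*\in (E_{\mathbb R})^*,\ \sup_{\|x\|\le 1}\sum_{i=1}^n|x_i^*(x)|\le 1\Big\},$$ it is the closed sublattice, generated by the evaluations $\delta_x(x^*)=x^*(x)$ $(x\in E)$, of the Banach lattice (with pointwise order) of all positively homogeneous functions $f:(E_{\mathbb R})^*\to\mathbb R$ with $\|f\|<\infty$. Let $\mathrm{FBL}_{\mathbb C}[E]=\mathrm{FBL}[E_{\mathbb R}]\oplus i\,\mathrm{FBL}[E_{\mathbb R}]$ be the free complex Banach lattice generated by $E$, with the norm $$\|f+ig\|_{\mathrm{FBL}_{\mathbb C}[E]}=\sup\Big\{\sum_{j=1}^m|(f+ig)(\mathfrak{Re}\,z_j^*)|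 : m\in\mathbb N,\ z_1^*,\dots,z_m^*\in E^*,\ \sup_{\|z\|\le 1}\sum_{j=1}^m|z_j^*(z)|\le 1\Big\}.$$ A functional $\varphi\in \mathrm{FBL}_{\mathbb C}[E]^*$ is called a lattice homomorphism if it is the complexification of a real lattice homomorphism, that is, $\varphi(f+ig)=S f+i\,S g$ for some linear lattice homomorphism $S:\mathrm{FBL}[E_{\mathbb R}]\to\mathbb R$. Then a functional $\varphi\in \mathrm{FBL}_{\mathbb C}[E]^*$ is a lattice homomorphism if and only if there is $z^*\in E^*$ such that $$\varphi(f+ig)=f(\mathfrak{Re}\,z^*)+i\,g(\mathfrak{Re}\,z^*)\qquad\text{for all } f+ig\in \mathrm{FBL}_{\mathbb C}[E].$$ -/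

import Mathlib

open scoped ENNReal

noncomputable section

section FreeNorm

variable {𝕜 E V : Type*} [RCLike 𝕜] [NormedAddCommGroup E] [NormedSpace 𝕜 E]
  [NormedAddCommGroup V]

/-- The tuple `x₁*, …, xₙ*` in the dual of `E` satisfies `sup_{z ∈ B_E} ∑ |xᵢ*(z)| ≤ 1`. -/
def IsAdmissible {n : ℕ} (x : Fin n → StrongDual 𝕜 E) : Prop :=
  ∀ z : E, ‖z‖ ≤ 1 → ∑ i, ‖x i z‖ ≤ 1

/-- The supremum of `∑ |f(xᵢ*)|` over all finite admissible tuples in `E*`, as a value in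
`[0, ∞]`. -/
def freeENorm (f : StrongDual 𝕜 E → V) : ℝ≥0∞ :=
  ⨆ (n : ℕ) (x : Fin n → StrongDual 𝕜 E) (_ : IsAdmissible x), ∑ i, ‖f (x i)‖ₑ

theorem sum_le_freeENorm (f : StrongDual 𝕜 E → V) {n : ℕ} {x : Fin n → StrongDual 𝕜 E}
    (hx : IsAdmissible x) : ∑ i, ‖f (x i)‖ₑ ≤ freeENorm f :=
  le_iSup_of_le n (le_iSup_of_le x (le_iSup_of_le hx le_rfl))

theorem freeENorm_le {f : StrongDual 𝕜 E → V} {C : ℝ≥0∞}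
    (h : ∀ (n : ℕ) (x : Fin n → StrongDual 𝕜 E), IsAdmissible x → ∑ i, ‖f (x i)‖ₑ ≤ C) :
    freeENorm f ≤ C :=
  iSup_le fun n => iSup_le fun x => iSup_le fun hx => h n x hx

theorem freeENorm_mono {W : Type*} [NormedAddCommGroup W] {f : StrongDual 𝕜 E → V}
    {g : StrongDual 𝕜 E → W} (h : ∀ x, ‖f x‖ ≤ ‖g x‖) : freeENorm f ≤ freeENorm g :=
  freeENorm_le fun _ x hx =>
    (Finset.sum_le_sum fun i _ => enorm_le_iff_norm_le.2 (h (x i))).trans (sum_le_freeENorm g hx)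

theorem freeENorm_add_le (f g : StrongDual 𝕜 E → V) :
    freeENorm (fun x => f x + g x) ≤ freeENorm f + freeENorm g := by
  refine freeENorm_le fun n x hx => ?_
  calc ∑ i, ‖f (x i) + g (x i)‖ₑ ≤ ∑ i, (‖f (x i)‖ₑ + ‖g (x i)‖ₑ) :=
        Finset.sum_le_sum fun i _ => enorm_add_le _ _
    _ = ∑ i, ‖f (x i)‖ₑ + ∑ i, ‖g (x i)‖ₑ := Finset.sum_add_distrib
    _ ≤ _ := add_le_add (sum_le_freeENorm f hx) (sum_le_freeENorm g hx)

theorem freeENorm_zero : freeENorm (fun _ : StrongDual 𝕜 E => (0 : V)) = 0 := by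
  simp [freeENorm]

theorem freeENorm_smul {𝕂 : Type*} [NormedField 𝕂] [NormedSpace 𝕂 V] (c : 𝕂)
    (f : StrongDual 𝕜 E → V) : freeENorm (fun x => c • f x) = ‖c‖ₑ * freeENorm f := by
  simp only [freeENorm, enorm_smul, ← Finset.mul_sum, ENNReal.mul_iSup]

theorem isAdmissible_single {x : StrongDual 𝕜 E} (hx : ‖x‖ ≤ 1) :
    IsAdmissible (fun _ : Fin 1 => x) := by
  intro z hz
  simp only [Finset.univ_unique, Finset.sum_const, Finset.card_singleton, one_smul]
  calc ‖x z‖ ≤ ‖x‖ * ‖z‖ := x.le_opNorm z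
    _ ≤ 1 := mul_le_one₀ hx (norm_nonneg _) hz

theorem eq_zero_of_freeENorm_eq_zero {f : StrongDual 𝕜 E → V} (h : freeENorm f = 0)
    {x : StrongDual 𝕜 E} (hx : ‖x‖ ≤ 1) : f x = 0 := by
  have := sum_le_freeENorm f (isAdmissible_single hx)
  simpa [h] using this

theorem freeENorm_eval_le (z : E) :
    freeENorm (fun x : StrongDual 𝕜 E => x z) ≤ ENNReal.ofReal ‖z‖ := by
  refine freeENorm_le fun n x hx => ?_
  have key : ∑ i, ‖x i z‖ ≤ ‖z‖ := by
    rcases eq_or_ne z 0 with rfl | hz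
    · simp
    · have hpos : 0 < ‖z‖ := norm_pos_iff.2 hz
      have h1 := hx (((‖z‖⁻¹ : ℝ) : 𝕜) • z) (by
        rw [norm_smul, RCLike.norm_ofReal, abs_of_pos (inv_pos.2 hpos),
          inv_mul_cancel₀ hpos.ne'])
      simp only [map_smul, norm_smul, RCLike.norm_ofReal, abs_of_pos (inv_pos.2 hpos),
        ← Finset.mul_sum] at h1
      rwa [inv_mul_le_iff₀ hpos, mul_one] at h1
  simp only [← ofReal_norm]
  rw [← ENNReal.ofReal_sum_of_nonneg fun i _ => norm_nonneg _]
  exact ENNReal.ofReal_le_ofReal key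

end FreeNorm

/-! ### The real free Banach lattice -/

section Real

/-- `H₁[F]`: the positively homogeneous functions `f : F* → ℝ` of finite free norm. -/
@[ext]
structure H1 (F : Type*) [NormedAddCommGroup F] [NormedSpace ℝ F] where
  toFun : StrongDual ℝ F → ℝ
  map_smul' : ∀ (c : ℝ) (x : StrongDual ℝ F), 0 ≤ c → toFun (c • x) = c * toFun x
  finite' : freeENorm toFun < ∞

namespace H1

variable {F : Type*} [NormedAddCommGroup F] [NormedSpace ℝ F]

instance : CoeFun (H1 F) fun _ => StrongDual ℝ F → ℝ := ⟨toFun⟩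

theorem toFun_injective : Function.Injective (toFun : H1 F → StrongDual ℝ F → ℝ) :=
  fun _ _ h => H1.ext h

theorem finite_smul (c : ℝ) (f : H1 F) : freeENorm (fun x => c * f x) < ∞ := by
  have := freeENorm_smul c f.toFun
  simp only [smul_eq_mul] at this
  rw [this]
  exact ENNReal.mul_lt_top enorm_lt_top f.finite'

theorem finite_add (f g : H1 F) : freeENorm (fun x => f x + g x) < ∞ :=
  (freeENorm_add_le _ _).trans_lt (ENNReal.add_lt_top.2 ⟨f.finite', g.finite'⟩)

theorem finite_abs_add (f g : H1 F) : freeENorm (fun x => |f x| + |g x|) < ∞ := by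
  refine (freeENorm_add_le _ _).trans_lt (ENNReal.add_lt_top.2 ⟨?_, ?_⟩)
  · exact (freeENorm_mono fun x => by simp).trans_lt f.finite'
  · exact (freeENorm_mono fun x => by simp).trans_lt g.finite'

instance : Zero (H1 F) := ⟨⟨fun _ => 0, by simp, by rw [freeENorm_zero]; simp⟩⟩

instance : Add (H1 F) :=
  ⟨fun f g => ⟨fun x => f x + g x,
    fun c x hc => by rw [f.map_smul' c x hc, g.map_smul' c x hc]; ring, finite_add f g⟩⟩

instance : SMul ℝ (H1 F) :=
  ⟨fun a f => ⟨fun x => a * f x,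
    fun c x hc => by rw [f.map_smul' c x hc]; ring, finite_smul a f⟩⟩

instance : SMul ℕ (H1 F) := ⟨fun n f => (n : ℝ) • f⟩

instance : SMul ℤ (H1 F) := ⟨fun n f => (n : ℝ) • f⟩

instance : Neg (H1 F) := ⟨fun f => (-1 : ℝ) • f⟩

instance : Sub (H1 F) := ⟨fun f g => f + -g⟩

instance : AddCommGroup (H1 F) :=
  toFun_injective.addCommGroup _ rfl (fun _ _ => rfl)
    (fun f => funext fun x => show (-1 : ℝ) * f x = - f x by ring)
    (fun f g => funext fun x => show f x + (-1 : ℝ) * g x = f x - g x by ring)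
    (fun f n => funext fun x => show (n : ℝ) * f x = n • f x by simp)
    (fun f n => funext fun x => show (n : ℝ) * f x = n • f x by simp)

/-- The inclusion of `H₁[F]` in the functions on `F*`, as an additive map. -/
def toFunHom : H1 F →+ (StrongDual ℝ F → ℝ) where
  toFun := H1.toFun
  map_zero' := rfl
  map_add' _ _ := rfl

instance : Module ℝ (H1 F) := toFun_injective.module ℝ toFunHom fun _ _ => rfl

/-- Pointwise order. -/
instance : PartialOrder (H1 F) := PartialOrder.lift toFun toFun_injective

/-- Pointwise lattice operations. -/
instance : Lattice (H1 F) where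
  sup f g := ⟨fun x => max (f x) (g x),
    fun c x hc => by rw [f.map_smul' c x hc, g.map_smul' c x hc, mul_max_of_nonneg _ _ hc],
    (freeENorm_mono fun x => by
      rw [Real.norm_eq_abs, Real.norm_eq_abs,
        abs_of_nonneg (add_nonneg (abs_nonneg (f x)) (abs_nonneg (g x)))]
      rcases max_choice (f x) (g x) with h | h <;> rw [h] <;>
        linarith [abs_nonneg (f x), abs_nonneg (g x)]).trans_lt (finite_abs_add f g)⟩
  inf f g := ⟨fun x => min (f x) (g x),
    fun c x hc => by rw [f.map_smul' c x hc, g.map_smul' c x hc, mul_min_of_nonneg _ _ hc],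
    (freeENorm_mono fun x => by
      rw [Real.norm_eq_abs, Real.norm_eq_abs,
        abs_of_nonneg (add_nonneg (abs_nonneg (f x)) (abs_nonneg (g x)))]
      rcases min_choice (f x) (g x) with h | h <;> rw [h] <;>
        linarith [abs_nonneg (f x), abs_nonneg (g x)]).trans_lt (finite_abs_add f g)⟩
  le_sup_left f g := fun x => le_max_left (f x) (g x)
  le_sup_right f g := fun x => le_max_right (f x) (g x)
  sup_le _ _ _ hf hg := fun x => max_le (hf x) (hg x)
  inf_le_left f g := fun x => min_le_left (f x) (g x)
  inf_le_right f g := fun x => min_le_right (f x) (g x)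
  le_inf _ _ _ hf hg := fun x => le_min (hf x) (hg x)

/-- The free norm on `H₁[F]`. -/
instance : Norm (H1 F) := ⟨fun f => (freeENorm f.toFun).toReal⟩

theorem eq_zero_of_freeENorm {f : H1 F} (h : freeENorm f.toFun = 0) : f = 0 := by
  refine H1.ext (funext fun x => ?_)
  have hn : 0 < ‖x‖ + 1 := by positivity
  have h1 : ‖(‖x‖ + 1)⁻¹ • x‖ ≤ 1 := by
    rw [norm_smul, Real.norm_eq_abs, abs_of_pos (inv_pos.2 hn), inv_mul_le_iff₀ hn]
    linarith
  have h2 := eq_zero_of_freeENorm_eq_zero h h1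
  rw [f.map_smul' _ _ (inv_nonneg.2 hn.le)] at h2
  exact (mul_eq_zero.1 h2).resolve_left (inv_ne_zero hn.ne')

theorem normCore : NormedSpace.Core ℝ (H1 F) where
  norm_nonneg _ := ENNReal.toReal_nonneg
  norm_smul c f := by
    change (freeENorm fun x => c • f x).toReal = _ * (freeENorm f.toFun).toReal
    rw [freeENorm_smul c f.toFun, ENNReal.toReal_mul, toReal_enorm]
  norm_triangle f g := by
    change (freeENorm fun x => f x + g x).toReal
      ≤ (freeENorm f.toFun).toReal + (freeENorm g.toFun).toReal
    rw [← ENNReal.toReal_add f.finite'.ne g.finite'.ne]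
    exact ENNReal.toReal_mono (ENNReal.add_lt_top.2 ⟨f.finite', g.finite'⟩).ne
      (freeENorm_add_le _ _)
  norm_eq_zero_iff f := by
    constructor
    · intro h
      refine eq_zero_of_freeENorm ?_
      exact ((ENNReal.toReal_eq_zero_iff _).1 h).resolve_right f.finite'.ne
    · rintro rfl
      change (freeENorm fun _ : StrongDual ℝ F => (0 : ℝ)).toReal = 0
      rw [freeENorm_zero, ENNReal.toReal_zero]

instance : NormedAddCommGroup (H1 F) := NormedAddCommGroup.ofCore normCore

instance : NormedSpace ℝ (H1 F) := NormedSpace.ofCore normCore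

/-- The evaluation function `δ_x : F* → ℝ`, `δ_x(x*) = x*(x)`. -/
def delta (x : F) : H1 F where
  toFun x' := x' x
  map_smul' c x' _ := by simp
  finite' := (freeENorm_eval_le (𝕜 := ℝ) x).trans_lt ENNReal.ofReal_lt_top

end H1

/-- `FBL[F]`: the closed sublattice of `H₁[F]` generated by the functions `δ_x`, `x ∈ F`, that is,
the smallest closed linear subspace that is stable under `⊔` (hence under `⊓`) and contains
every `δ_x`. -/
def FBL (F : Type*) [NormedAddCommGroup F] [NormedSpace ℝ F] : Submodule ℝ (H1 F) :=
  sInf {M | IsClosed (M : Set (H1 F)) ∧ (∀ f ∈ M, ∀ g ∈ M, f ⊔ g ∈ M) ∧ ∀ x, H1.delta x ∈ M}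

namespace FBL

variable {F : Type*} [NormedAddCommGroup F] [NormedSpace ℝ F]

theorem sup_mem {f g : H1 F} (hf : f ∈ FBL F) (hg : g ∈ FBL F) : f ⊔ g ∈ FBL F := by
  rw [FBL, Submodule.mem_sInf] at *
  exact fun M hM => hM.2.1 f (hf M hM) g (hg M hM)

theorem inf_mem {f g : H1 F} (hf : f ∈ FBL F) (hg : g ∈ FBL F) : f ⊓ g ∈ FBL F := by
  have h : f ⊓ g = f + g - f ⊔ g := by
    refine H1.ext (funext fun x => ?_)
    change min (f x) (g x) = (H1.toFunHom (f + g - f ⊔ g)) x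
    rw [map_sub, map_add]
    change _ = f x + g x - max (f x) (g x)
    linarith [min_add_max (f x) (g x)]
  rw [h]
  exact (FBL F).sub_mem ((FBL F).add_mem hf hg) (sup_mem hf hg)

/-- The lattice structure of `FBL[F]` inherited from `H₁[F]`, i.e. the pointwise one. -/
instance : Lattice (FBL F) :=
  Subtype.lattice (fun _ _ hf hg => sup_mem hf hg) fun _ _ hf hg => inf_mem hf hg

instance : CoeFun (FBL F) fun _ => StrongDual ℝ F → ℝ := ⟨fun f => f.1.toFun⟩

end FBL

end Real

/-! ### The complex free Banach lattice -/

section Complex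

variable {E : Type*} [NormedAddCommGroup E] [NormedSpace ℂ E]

/-- The real part `Re z*` of a complex functional `z*`, a functional on the underlying real
space of `E`. -/
def rePart (z : StrongDual ℂ E) : StrongDual ℝ E := Complex.reCLM ∘L z.restrictScalars ℝ

theorem rePart_surjective : Function.Surjective (rePart : StrongDual ℂ E → StrongDual ℝ E) := by
  intro x
  refine ⟨StrongDual.extendRCLike x, ?_⟩
  ext v
  simp [rePart, StrongDual.extendRCLike_apply]

theorem rePart_real_smul (c : ℝ) (z : StrongDual ℂ E) :
    rePart ((c : ℂ) • z) = c • rePart z := by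
  ext v
  simp [rePart]

theorem IsAdmissible.rePart {n : ℕ} {z : Fin n → StrongDual ℂ E} (hz : IsAdmissible z) :
    IsAdmissible fun i => rePart (z i) := fun v hv =>
  (Finset.sum_le_sum fun i _ => Complex.abs_re_le_norm (z i v)).trans (hz v hv)

/-- `FBL_ℂ[E] = FBL[E_ℝ] ⊕ i FBL[E_ℝ]`, where `E_ℝ` is `E` regarded as a real space; `⟨f, g⟩`
stands for `f + i g`. -/
@[ext]
structure FBLC (E : Type*) [NormedAddCommGroup E] [NormedSpace ℂ E] where
  re : FBL E
  im : FBL E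

namespace FBLC

/-- The complex function `x* ↦ f(x*) + i g(x*)` on `(E_ℝ)*` given by `f + i g`. -/
def eval (h : FBLC E) (x : StrongDual ℝ E) : ℂ := (h.re x : ℂ) + Complex.I * (h.im x : ℂ)

instance : Zero (FBLC E) := ⟨⟨0, 0⟩⟩

instance : Add (FBLC E) := ⟨fun h k => ⟨h.re + k.re, h.im + k.im⟩⟩

instance : Neg (FBLC E) := ⟨fun h => ⟨-h.re, -h.im⟩⟩

instance : Sub (FBLC E) := ⟨fun h k => ⟨h.re - k.re, h.im - k.im⟩⟩

instance : SMul ℕ (FBLC E) := ⟨fun n h => ⟨n • h.re, n • h.im⟩⟩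

instance : SMul ℤ (FBLC E) := ⟨fun n h => ⟨n • h.re, n • h.im⟩⟩

theorem pair_injective : Function.Injective fun h : FBLC E => (h.re, h.im) := by
  rintro ⟨a, b⟩ ⟨c, d⟩ h
  simpa using h

instance : AddCommGroup (FBLC E) :=
  pair_injective.addCommGroup _ rfl (fun _ _ => rfl) (fun _ => rfl) (fun _ _ => rfl)
    (fun _ _ => rfl) (fun _ _ => rfl)

/-- `(a + i b)(f + i g) = (a f - b g) + i (b f + a g)`. -/
instance : SMul ℂ (FBLC E) :=
  ⟨fun c h => ⟨c.re • h.re - c.im • h.im, c.im • h.re + c.re • h.im⟩⟩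

@[simp] theorem zero_re : (0 : FBLC E).re = 0 := rfl
@[simp] theorem zero_im : (0 : FBLC E).im = 0 := rfl
@[simp] theorem add_re (h k : FBLC E) : (h + k).re = h.re + k.re := rfl
@[simp] theorem add_im (h k : FBLC E) : (h + k).im = h.im + k.im := rfl
@[simp] theorem smul_re (c : ℂ) (h : FBLC E) : (c • h).re = c.re • h.re - c.im • h.im := rfl
@[simp] theorem smul_im (c : ℂ) (h : FBLC E) : (c • h).im = c.im • h.re + c.re • h.im := rfl

instance : Module ℂ (FBLC E) where
  one_smul h := by ext1 <;> simp
  mul_smul c d h := by ext1 <;> simp <;> module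
  smul_zero c := by ext1 <;> simp
  smul_add c h k := by ext1 <;> simp <;> module
  add_smul c d h := by ext1 <;> simp <;> module
  zero_smul h := by ext1 <;> simp

/-- The norm `‖f + i g‖ = sup ∑ |(f + i g)(Re z_j*)|`, over all finite tuples in the complex dual
`E*` with `sup_{z ∈ B_E} ∑ |z_j*(z)| ≤ 1`. The supremum is finite by `freeENorm_lt_top`. -/
instance : Norm (FBLC E) :=
  ⟨fun h => (freeENorm fun z : StrongDual ℂ E => h.eval (rePart z)).toReal⟩

theorem freeENorm_rePart_le {V : Type*} [NormedAddCommGroup V] (f : StrongDual ℝ E → V) :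
    freeENorm (fun z : StrongDual ℂ E => f (rePart z)) ≤ freeENorm f :=
  freeENorm_le fun _ _ hz => sum_le_freeENorm f hz.rePart

theorem freeENorm_lt_top (h : FBLC E) :
    freeENorm (fun z : StrongDual ℂ E => h.eval (rePart z)) < ∞ := by
  refine (freeENorm_rePart_le h.eval).trans_lt ?_
  refine (freeENorm_mono fun x => ?_).trans_lt (H1.finite_abs_add h.re.1 h.im.1)
  calc ‖h.eval x‖ ≤ ‖(h.re x : ℂ)‖ + ‖Complex.I * (h.im x : ℂ)‖ := norm_add_le _ _
    _ = |h.re x| + |h.im x| := by simp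
    _ ≤ ‖|h.re x| + |h.im x|‖ := le_abs_self _

theorem eval_add (h k : FBLC E) (x : StrongDual ℝ E) : (h + k).eval x = h.eval x + k.eval x := by
  change ((h.re x + k.re x : ℝ) : ℂ) + Complex.I * ((h.im x + k.im x : ℝ) : ℂ) = _
  simp only [eval]
  push_cast
  ring

theorem eval_smul (c : ℂ) (h : FBLC E) (x : StrongDual ℝ E) : (c • h).eval x = c • h.eval x := by
  have h1 : (c • h).re x = c.re * h.re x - c.im * h.im x := by
    change H1.toFunHom (c.re • h.re.1 - c.im • h.im.1) x = _
    rw [map_sub]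
    rfl
  have h2 : (c • h).im x = c.im * h.re x + c.re * h.im x := rfl
  simp only [eval]
  rw [h1, h2]
  apply Complex.ext <;> simp <;> ring

theorem normCore : NormedSpace.Core ℂ (FBLC E) where
  norm_nonneg _ := ENNReal.toReal_nonneg
  norm_smul c h := by
    change (freeENorm fun z : StrongDual ℂ E => (c • h).eval (rePart z)).toReal =
      _ * (freeENorm fun z : StrongDual ℂ E => h.eval (rePart z)).toReal
    simp only [eval_smul]
    rw [freeENorm_smul c fun z : StrongDual ℂ E => h.eval (rePart z), ENNReal.toReal_mul,
      toReal_enorm]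
  norm_triangle h k := by
    change (freeENorm fun z : StrongDual ℂ E => (h + k).eval (rePart z)).toReal ≤
      (freeENorm fun z : StrongDual ℂ E => h.eval (rePart z)).toReal +
      (freeENorm fun z : StrongDual ℂ E => k.eval (rePart z)).toReal
    simp only [eval_add]
    rw [← ENNReal.toReal_add h.freeENorm_lt_top.ne k.freeENorm_lt_top.ne]
    exact ENNReal.toReal_mono
      (ENNReal.add_lt_top.2 ⟨h.freeENorm_lt_top, k.freeENorm_lt_top⟩).ne (freeENorm_add_le _ _)
  norm_eq_zero_iff h := by
    constructor
    · intro h0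
      have h1 : freeENorm (fun z : StrongDual ℂ E => h.eval (rePart z)) = 0 :=
        ((ENNReal.toReal_eq_zero_iff _).1 h0).resolve_right h.freeENorm_lt_top.ne
      have key : ∀ x : StrongDual ℝ E, h.eval x = 0 := by
        intro x
        obtain ⟨z, rfl⟩ := rePart_surjective x
        have hn : 0 < ‖z‖ + 1 := by positivity
        have h2 : ‖(((‖z‖ + 1)⁻¹ : ℝ) : ℂ) • z‖ ≤ 1 := by
          rw [norm_smul, Complex.norm_real, Real.norm_eq_abs, abs_of_pos (inv_pos.2 hn),
            inv_mul_le_iff₀ hn]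
          linarith
        have h3 := eq_zero_of_freeENorm_eq_zero h1 h2
        simp only [rePart_real_smul, eval] at h3
        rw [h.re.1.map_smul' _ _ (inv_nonneg.2 hn.le),
          h.im.1.map_smul' _ _ (inv_nonneg.2 hn.le)] at h3
        have hc : (((‖z‖ + 1)⁻¹ : ℝ) : ℂ) ≠ 0 := by exact_mod_cast (inv_ne_zero hn.ne')
        refine (mul_eq_zero.1 (?_ : (((‖z‖ + 1)⁻¹ : ℝ) : ℂ) * h.eval (rePart z) = 0)).resolve_left hc
        rw [← h3, eval, Complex.ofReal_mul, Complex.ofReal_mul]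
        ring
      apply FBLC.ext
      · refine Subtype.ext (H1.ext (funext fun x => ?_))
        have := congrArg Complex.re (key x)
        refine Eq.trans ?_ (this.trans rfl)
        simp [eval]
      · refine Subtype.ext (H1.ext (funext fun x => ?_))
        have := congrArg Complex.im (key x)
        refine Eq.trans ?_ (this.trans rfl)
        simp [eval]
    · rintro rfl
      change (freeENorm fun z : StrongDual ℂ E => (0 : FBLC E).eval (rePart z)).toReal = 0
      have h0 : ∀ x : StrongDual ℝ E, (0 : FBLC E).eval x = 0 := fun x => by
        change (((0 : ℝ) : ℂ) + Complex.I * ((0 : ℝ) : ℂ)) = 0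
        simp
      simp only [h0]
      rw [freeENorm_zero, ENNReal.toReal_zero]

instance : NormedAddCommGroup (FBLC E) := NormedAddCommGroup.ofCore normCore

instance : NormedSpace ℂ (FBLC E) := NormedSpace.ofCore normCore

/-- A functional `φ ∈ FBL_ℂ[E]*` is a lattice homomorphism if it is the complexification
`φ(f + i g) = S f + i S g` of a real lattice homomorphism `S : FBL[E_ℝ] → ℝ`, i.e. of a linear
map `S` preserving `⊔` and `⊓` (such an `S` is bounded because `φ` is). -/
def IsLatticeHom (φ : StrongDual ℂ (FBLC E)) : Prop :=
  ∃ S : FBL E →ₗ[ℝ] ℝ,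
    (∀ f g : FBL E, S (f ⊔ g) = S f ⊔ S g) ∧ (∀ f g : FBL E, S (f ⊓ g) = S f ⊓ S g) ∧
    ∀ f g : FBL E, φ ⟨f, g⟩ = (S f : ℂ) + Complex.I * (S g : ℂ)

end FBLC

end Complex

end

/-! ### Continuity of point evaluations and of `δ`. -/

namespace H1

variable {F : Type*} [NormedAddCommGroup F] [NormedSpace ℝ F]

/-! A lattice homomorphism on a free object is determined by its values on the generators. A bounded
real lattice homomorphism `S` on `FBL[F]` gives the functional `x = S ∘ δ` in the dual of `F`. Both
`S` and evaluation at `x` are continuous, linear and compatible with `⊔`, and they agree on every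
`δ_v`. The set where they agree is therefore a closed sublattice containing the generators, that is,
all of `FBL[F]` (`FBL.eq_eval_of_map_sup`). The complex statement reduces to this real one: `S`
inherits its bound from `φ` (`FBLC.norm_mk_zero_le`), and every real functional on `E` is the real
part of a complex one (`rePart_surjective`). Conversely, point evaluations are lattice homomorphisms
because the operations are pointwise. -/

theorem abs_apply_le (f : H1 F) (x : StrongDual ℝ F) : |f x| ≤ (‖x‖ + 1) * ‖f‖ := by
  have hn : 0 < ‖x‖ + 1 := by positivity
  -- A functional of norm at most 1 is an admissible tuple of length one. Dividing by `‖x‖ + 1`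
  -- instead of `‖x‖` avoids treating `x = 0` separately.
  have h1 : ‖(‖x‖ + 1)⁻¹ • x‖ ≤ 1 := by
    rw [norm_smul, Real.norm_eq_abs, abs_of_pos (inv_pos.2 hn), inv_mul_le_iff₀ hn]
    linarith
  have h2 := ENNReal.toReal_mono f.finite'.ne (sum_le_freeENorm f.toFun (isAdmissible_single h1))
  simp only [Finset.univ_unique, Finset.sum_const, Finset.card_singleton, one_smul,
    toReal_enorm, Real.norm_eq_abs] at h2
  rw [f.map_smul' _ _ (inv_nonneg.2 hn.le), abs_mul, abs_of_pos (inv_pos.2 hn),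
    inv_mul_le_iff₀ hn] at h2
  exact h2

/-- This makes `v ↦ S (δ_v)` bounded for bounded `S`, so that it is a point of the dual of `F`. -/
theorem norm_delta_le (x : F) : ‖delta x‖ ≤ ‖x‖ :=
  ENNReal.toReal_le_of_le_ofReal (norm_nonneg x) (freeENorm_eval_le (𝕜 := ℝ) x)

/-- Evaluation at `x`, as a continuous linear functional on `H₁[F]`. -/
noncomputable def evalCLM (x : StrongDual ℝ F) : H1 F →L[ℝ] ℝ :=
  LinearMap.mkContinuous
    { toFun := fun f => f x
      map_add' := fun _ _ => rfl
      map_smul' := fun _ _ => rfl } (‖x‖ + 1) fun f => f.abs_apply_le x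

end H1

/-! ### Bounded lattice homomorphisms on the real space `FBL[F]`. -/

namespace FBL

variable {F : Type*} [NormedAddCommGroup F] [NormedSpace ℝ F]

theorem delta_mem (x : F) : H1.delta x ∈ FBL F :=
  Submodule.mem_sInf.2 fun _ hM => hM.2.2 x

theorem isClosed : IsClosed (FBL F : Set (H1 F)) := by
  rw [FBL, Submodule.coe_sInf]
  exact isClosed_biInter fun _ hM => hM.1

/-- The canonical embedding `x ↦ δ_x` of `F` in `FBL[F]`. -/
noncomputable def deltaCLM : F →L[ℝ] FBL F :=
  LinearMap.mkContinuous
    { toFun := fun x => ⟨H1.delta x, delta_mem x⟩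
      map_add' := fun x y => Subtype.ext (H1.ext (funext fun z => map_add z x y))
      map_smul' := fun c x => Subtype.ext (H1.ext (funext fun z => map_smul z c x)) } 1
    fun x => by simpa using H1.norm_delta_le x

/-- A bounded lattice homomorphism `S : FBL[F] → ℝ` is the evaluation at the functional
`x ↦ S(δ_x)`. -/
theorem eq_eval_of_map_sup (S : FBL F →L[ℝ] ℝ) (hS : ∀ f g : FBL F, S (f ⊔ g) = S f ⊔ S g)
    (f : FBL F) : S f = f (S ∘L deltaCLM) := by
  set x : StrongDual ℝ F := S ∘L deltaCLM with hx
  -- The agreement set of `S` and evaluation at `x` is the kernel of `D`, hence a closed subspace.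
  let D : FBL F →L[ℝ] ℝ := S - H1.evalCLM x ∘L (FBL F).subtypeL
  have hD : ∀ h : FBL F, D h = 0 ↔ S h = h x := fun h => sub_eq_zero
  -- `FBL F` is minimal among subspaces of `H1 F`, while the kernel of `D` lives inside `FBL F`; its
  -- image in `H1 F` is what minimality applies to.
  have hM : FBL F ≤ (LinearMap.ker (D : FBL F →ₗ[ℝ] ℝ)).map (FBL F).subtype := by
    refine sInf_le ⟨?_, ?_, ?_⟩
    · rw [Submodule.map_coe]
      exact isClosed.isClosedEmbedding_subtypeVal.isClosedMap _ D.isClosed_ker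
    · rintro _ ⟨g, hg, rfl⟩ _ ⟨h, hh, rfl⟩
      refine ⟨g ⊔ h, (hD _).2 ?_, rfl⟩
      rw [hS, (hD g).1 hg, (hD h).1 hh]
      rfl
    · exact fun v => ⟨deltaCLM v, (hD _).2 rfl, rfl⟩
  obtain ⟨g, hg, hgf⟩ := hM f.2
  obtain rfl : g = f := Subtype.ext hgf
  exact (hD g).1 hg

end FBL

/-! ### From real to complex lattice homomorphisms. -/

/-- The real parts of an admissible complex tuple form an admissible real tuple, so the complex norm
is a supremum over fewer tuples than the real one. -/
theorem FBLC.norm_mk_zero_le {E : Type*} [NormedAddCommGroup E] [NormedSpace ℂ E] (f : FBL E) :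
    ‖(⟨f, 0⟩ : FBLC E)‖ ≤ ‖f‖ := by
  refine ENNReal.toReal_mono f.1.finite'.ne
    (le_trans ?_ (FBLC.freeENorm_rePart_le (E := E) f.1.toFun))
  refine freeENorm_mono fun z => ?_
  change ‖((f (rePart z) : ℝ) : ℂ) + Complex.I * ((0 : ℝ) : ℂ)‖ ≤ _
  simp

theorem mainTheorem10 {E : Type*} [NormedAddCommGroup E] [NormedSpace ℂ E] [CompleteSpace E]
    (φ : StrongDual ℂ (FBLC E)) :
    FBLC.IsLatticeHom φ ↔
      ∃ z : StrongDual ℂ E, ∀ f g : FBL E,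
        φ ⟨f, g⟩ = (f (rePart z) : ℂ) + Complex.I * (g (rePart z) : ℂ) := by
  constructor
  · rintro ⟨S, hsup, -, hφ⟩
    -- `S` is only assumed linear; restricting `φ` to the elements `f + i0` bounds it.
    have hS : ∀ f : FBL E, ‖S f‖ ≤ ‖φ‖ * ‖f‖ := fun f => by
      have h : φ ⟨f, 0⟩ = (S f : ℂ) := by rw [hφ, map_zero]; simp
      calc ‖S f‖ = ‖φ ⟨f, 0⟩‖ := by rw [h, Complex.norm_real]
        _ ≤ ‖φ‖ * ‖(⟨f, 0⟩ : FBLC E)‖ := φ.le_opNorm _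
        _ ≤ ‖φ‖ * ‖f‖ := by gcongr; exact FBLC.norm_mk_zero_le f
    have key := FBL.eq_eval_of_map_sup (S.mkContinuous ‖φ‖ hS) hsup
    -- The complex functional whose real part is `x = S ∘ δ` is `v ↦ x(v) - i x(iv)`.
    obtain ⟨z, hz⟩ := rePart_surjective (S.mkContinuous ‖φ‖ hS ∘L FBL.deltaCLM)
    rw [← hz] at key
    exact ⟨z, fun f g => by rw [hφ, ← key f, ← key g]; rfl⟩
  · rintro ⟨z, hz⟩
    exact ⟨(H1.evalCLM (rePart z)).toLinearMap ∘ₗ (FBL E).subtype,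
      fun _ _ => rfl, fun _ _ => rfl, hz⟩
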